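/- Let $G$ be a finite simple connected unicyclic graph with unique cycle $C$ of length $l$. For vertices $a,b$ let $H(a,b)$ be the hitting time, i.e. the expected number of steps that the simple random walk on $G$ (which moves from $x$ to each neighbour of $x$ with probability $1/d_x$, $d_x$ the degree of $x$) started at $a$ needs to reach $b$, and let $d(\cdot,\cdot)$ be the graph distance. For $i\in V(C)$ let $T_i$ be the component of $G\setminus E(C)$ containing $i$. For vertices $x,y$ joined by a unique path, $P_{xy}$ denotes that path. (1) Suppose $a\in V(T_i)$ and $b\in V(T_j)$ for two distinct $i,j\in V(C)$. Let $G_0$ be the subgraph of $G$ induced by $V(P_{ai})\cup V(P_{jb})\cup V(C)$, and for $v\in V(G_0)$ let $m_v$ be the number of edges in the component of $G\setminus E(G_0)$ containing $v$. For $k\in V(C)\setminus\{i,j\}$ let $P_{ijk}$ be the path in $C$ from $i$ to $k$ containing $j$, and let $m_{ij}$ and $m_{jk}$ be the lengths of its subpaths from $i$ to $j$ and from $j$ to $k$ (both depend on $k$). Then $H(a,b)$ is finite and $$\begin{aligned}H(a,b)={}&2\sum_{v\in P_{ai}}m_v\left(d(v,i)+d(j,b)+\frac{d(i,j)(l-d(i,j))}{l}\right)+2\sum_{v\in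 P_{jb}}m_v\,d(v,b)\\&+2\sum_{k\in V(C)\setminus\{i,j\}}m_k\left(d(j,b)+\frac{m_{ij}m_{jk}}{l}\right)\\&+d(a,i)^2+d(j,b)^2+2\bigl(l+d(a,i)\bigr)d(j,b)+\frac{l+2d(a,i)}{l}\,d(i,j)\bigl(l-d(i,j)\bigr).\end{aligned}$$ (2) Suppose $a,b\in V(T_i)$ for some $i\in V(C)$. Let $P=P_{ab}$, and for $v\in V(P)$ let $m_v$ be the number of edges in the component of $G\setminus E(P)$ containing $v$. Then $H(a,b)$ is finite and $$H(a,b)=d(a,b)^2+2\sum_{v\in V(P)}m_v\,d(v,b).$$ -/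

import Mathlib

open scoped ENNReal

namespace UnicyclicHitting

noncomputable section

variable {V : Type*}

/-! ### Simple random walk and hitting times -/

/-- One step of the simple random walk on a finite graph: from `x`, move to a uniformly chosen
neighbour of `x`, i.e. to each neighbour with probability `1 / d_x`. (At an isolated vertex the
walk stays put; this case does not occur in a connected graph with an edge.) -/
def stepLaw [Finite V] (G : SimpleGraph V) (x : V) : PMF V :=
  open Classical in
  if h : (Set.toFinite (G.neighborSet x)).toFinset.Nonempty then
    PMF.uniformOfFinset (Set.toFinite (G.neighborSet x)).toFinset h
  else PMF.pure x

/-- The transition kernel of the simple random walk. -/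
def stepKernel [Finite V] [MeasurableSpace V] [DiscreteMeasurableSpace V] (G : SimpleGraph V) :
    ProbabilityTheory.Kernel V V :=
  ProbabilityTheory.Kernel.ofFunOfCountable fun x => (stepLaw G x).toMeasure

instance [Finite V] [MeasurableSpace V] [DiscreteMeasurableSpace V] (G : SimpleGraph V) :
    ProbabilityTheory.IsMarkovKernel (stepKernel G) :=
  ⟨fun x => inferInstanceAs (MeasureTheory.IsProbabilityMeasure (stepLaw G x).toMeasure)⟩

/-- The kernel giving the law of the position at time `n + 1` from the positions up to time `n`:
only the position at time `n` matters. -/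
def historyKernel [Finite V] [MeasurableSpace V] [DiscreteMeasurableSpace V] (G : SimpleGraph V)
    (n : ℕ) : ProbabilityTheory.Kernel (Finset.Iic n → V) V :=
  (stepKernel G).comap (fun h => h ⟨n, Finset.mem_Iic.2 le_rfl⟩) (measurable_pi_apply _)

instance [Finite V] [MeasurableSpace V] [DiscreteMeasurableSpace V] (G : SimpleGraph V) (n : ℕ) :
    ProbabilityTheory.IsMarkovKernel (historyKernel G n) :=
  inferInstanceAs (ProbabilityTheory.IsMarkovKernel ((stepKernel G).comap _ _))

/-- The law, on the space `ℕ → V` of trajectories, of the simple random walk started at `a`. -/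
def walkLaw [Finite V] [MeasurableSpace V] [DiscreteMeasurableSpace V] (G : SimpleGraph V)
    (a : V) : MeasureTheory.Measure (ℕ → V) :=
  ProbabilityTheory.Kernel.traj (X := fun _ => V) (historyKernel G) 0 (fun _ => a)

/-- The first time at which the trajectory `ω` is at `b` (`∞` if this never happens). -/
def firstHit (b : V) (ω : ℕ → V) : ℝ≥0∞ := ⨅ (n : ℕ) (_ : ω n = b), (n : ℝ≥0∞)

/-- The hitting time `H(a, b)`: the expected number of steps that the simple random walk on `G`
started at `a` needs to reach `b`. The finite vertex set carries the discrete `σ`-algebra. -/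
def hittingTime [Finite V] (G : SimpleGraph V) (a b : V) : ℝ≥0∞ :=
  letI : MeasurableSpace V := ⊤
  ∫⁻ ω, firstHit b ω ∂(walkLaw G a)

/-! ### Unicyclic graphs -/

/-- `C` is a cycle of `G`, as a subgraph. -/
def IsCycleIn (G : SimpleGraph V) (C : G.Subgraph) : Prop :=
  ∃ (v : V) (c : G.Walk v v), c.IsCycle ∧ c.toSubgraph = C

/-- `G` is a connected unicyclic graph and `C` is its unique cycle. -/
structure IsUnicyclicWith (G : SimpleGraph V) (C : G.Subgraph) : Prop where
  connected : G.Connected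
  isCycle : IsCycleIn G C
  unique : ∀ C' : G.Subgraph, IsCycleIn G C' → C' = C

/-- The vertex set of the component of `G \ E(K)` containing `v`. For `K = C` the unique cycle
and `i` on `C`, `componentVerts G C i` is the vertex set of the tree branch `T_i`. -/
def componentVerts (G : SimpleGraph V) (K : G.Subgraph) (v : V) : Set V :=
  {u | (G.deleteEdges K.edgeSet).Reachable v u}

/-- The number `m_v` of edges in the component of `G \ E(K)` containing `v`. -/
def componentEdgeCount (G : SimpleGraph V) (K : G.Subgraph) (v : V) : ℕ :=
  {e ∈ (G.deleteEdges K.edgeSet).edgeSet | ∀ u ∈ e, u ∈ componentVerts G K v}.ncard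

/-- The length `m_{ij}` of the subpath from `i` to `j` of the path `P_{ijk}`, where `P_{ijk}` is
the path in the cycle `C` from `i` to `k` containing `j` (for distinct vertices `i`, `j`, `k` of
`C`); here `P_{ijk}` is written as the concatenation of `p` from `i` to `j` and `q` from `j`
to `k`. There is exactly one such path, so the infimum is over a one-element set. -/
def firstArcLength {G : SimpleGraph V} (C : G.Subgraph) (i j k : V) : ℕ :=
  sInf {n | ∃ (p : G.Walk i j) (q : G.Walk j k),
    (p.append q).IsPath ∧ (p.append q).toSubgraph ≤ C ∧ p.length = n}

/-- The length `m_{jk}` of the subpath from `j` to `k` of the path `P_{ijk}`, with `P_{ijk}` as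
in `firstArcLength`. -/
def secondArcLength {G : SimpleGraph V} (C : G.Subgraph) (i j k : V) : ℕ :=
  sInf {n | ∃ (p : G.Walk i j) (q : G.Walk j k),
    (p.append q).IsPath ∧ (p.append q).toSubgraph ≤ C ∧ q.length = n}

/-- The subgraph `G_0` of `G` induced by the vertices of the path `p` (from `a` to `i`), of the
path `q` (from `j` to `b`) and of the cycle `C`. -/
def coreSubgraph {G : SimpleGraph V} (C : G.Subgraph) {a i j b : V} (p : G.Walk a i)
    (q : G.Walk j b) : G.Subgraph :=
  (⊤ : G.Subgraph).induce ({v | v ∈ p.support} ∪ {v | v ∈ q.support} ∪ C.verts)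

end

end UnicyclicHitting

/-! For fixed `b`, the function h = H(·, b) solves h(b) = 0 and Σ_{y ~ x} (h(x) − h(y)) = d_x for x
≠ b. On a connected graph this system has a nonnegative solution (`exists_isHittingSolution`), and
any such solution equals the expectation, which is therefore finite
(`IsHittingSolution.hittingTime_eq`).

The value h(a) is then read off by duality. Pairing the system with a φ vanishing at b gives Σ_{xy}
(φ(x) − φ(y))(h(x) − h(y)) = Σ_{xy} (φ(x) + φ(y)), both sums over edges. Take for φ the potential of
a unit current from a to b, grounded at b. It is constant on each branch hanging off the core K (the
path P, or G_0), so the left side lives on K and telescopes to h(a), while a branch at v contributes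
2 m_v φ(v) to the right side (`IsHittingSolution.sum_edges_eq`).

Along tree paths φ has slope 1. The arcs A, B of the cycle are resistors in parallel: φ has slope
|B|/l on A and |A|/l on B, and the resistance between i and j is |A||B|/l = d(l − d)/l. The graph
theory behind this is that edges off C are bridges, and that deleting one edge of C leaves a forest.
-/

namespace UnicyclicHitting

open MeasureTheory ProbabilityTheory Preorder

/-! ### Survival indicators and the first hitting time -/

section Avoids

variable {V : Type*}

open Classical in
/-- The indicator that the trajectory has avoided `b` up to time `n`. -/
noncomputable def avoids (b : V) (n : ℕ) (ω : ℕ → V) : ℝ≥0∞ :=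
  if ∀ k ≤ n, ω k ≠ b then 1 else 0

theorem avoids_succ (b : V) (n : ℕ) (ω : ℕ → V) [Decidable (ω (n + 1) = b)] :
    avoids b (n + 1) ω = avoids b n ω * (if ω (n + 1) = b then 0 else 1) := by
  unfold avoids
  by_cases h : ∀ k ≤ n, ω k ≠ b
  · by_cases h' : ω (n + 1) = b
    · have : ¬ ∀ k ≤ n + 1, ω k ≠ b := fun H => H _ le_rfl h'
      simp [h', this]
    · have : ∀ k ≤ n + 1, ω k ≠ b := fun k hk => by
        rcases Nat.le_succ_iff.1 hk with hk | rfl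
        exacts [h k hk, h']
      rw [if_pos this, if_pos h, if_neg h', one_mul]
  · have : ¬ ∀ k ≤ n + 1, ω k ≠ b := fun H => h fun k hk => H k (hk.trans n.le_succ)
    rw [if_neg this, if_neg h, zero_mul]

theorem avoids_eq_comp (b : V) (n : ℕ) : ∃ F : (Finset.Iic n → V) → ℝ≥0∞,
    ∀ ω, avoids b n ω = F (frestrictLe n ω) := by
  classical
  refine ⟨fun x => if ∀ k, x k ≠ b then 1 else 0, fun ω => ?_⟩
  simp [avoids]

/-- Tail-sum formula: each time strictly before the first visit contributes 1, and a trajectory that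
never visits gives ∞ on both sides. -/
theorem firstHit_eq_tsum (b : V) (ω : ℕ → V) : firstHit b ω = ∑' n, avoids b n ω := by
  classical
  unfold firstHit avoids
  by_cases h : ∃ n, ω n = b
  · have hN : ∀ n, (∀ k ≤ n, ω k ≠ b) ↔ n ∈ Finset.range (Nat.find h) := fun n => by
      rw [Finset.mem_range, Nat.lt_find_iff]
    simp_rw [hN]
    rw [tsum_eq_sum (s := Finset.range (Nat.find h)) fun n hn => if_neg hn,
      Finset.sum_congr rfl fun n hn => if_pos hn]
    simp only [Finset.sum_const, Finset.card_range, nsmul_eq_mul, mul_one]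
    refine le_antisymm (iInf₂_le (Nat.find h) (Nat.find_spec h)) (le_iInf₂ fun n hn => ?_)
    exact_mod_cast Nat.find_min' h hn
  · push Not at h
    simp [h]

end Avoids

/-! ### Markov property of the walk -/

section Walk

variable {V : Type*} [Finite V] [MeasurableSpace V] [DiscreteMeasurableSpace V]

/-- The Markov property of the simple random walk, in integrated form. -/
theorem lintegral_walkLaw_succ (G : SimpleGraph V) (a : V) (n : ℕ)
    (F : (Finset.Iic n → V) → ℝ≥0∞) (g : V → ℝ≥0∞) :
    ∫⁻ ω, F (frestrictLe n ω) * g (ω (n + 1)) ∂(walkLaw G a) =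
      ∫⁻ ω, F (frestrictLe n ω) * ∫⁻ y, g y ∂(stepLaw G (ω n)).toMeasure ∂(walkLaw G a) := by
  have hF : Measurable F := measurable_of_countable F
  have hg : Measurable g := measurable_of_countable g
  have key := Kernel.partialTraj_compProd_eq_map_traj (X := fun _ => V) (κ := historyKernel G)
    (Nat.zero_le n) (x₀ := fun _ => a)
  have h1 : ∫⁻ ω, F (frestrictLe n ω) * g (ω (n + 1)) ∂(walkLaw G a) =
      ∫⁻ z, F z.1 * g z.2 ∂((Kernel.traj (X := fun _ => V) (historyKernel G) 0 (fun _ => a)).map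
        (fun x ↦ (frestrictLe n x, x (n + 1)))) := by
    rw [lintegral_map]
    · rfl
    · exact (hF.comp measurable_fst).mul (hg.comp measurable_snd)
    · fun_prop
  have hFg : Measurable fun z : (Finset.Iic n → V) × V => F z.1 * g z.2 :=
    (hF.comp measurable_fst).mul (hg.comp measurable_snd)
  rw [h1, ← key, Measure.lintegral_compProd hFg, ← Kernel.traj_map_frestrictLe_apply, lintegral_map]
  · refine lintegral_congr fun ω => ?_
    exact lintegral_const_mul (μ := (stepLaw G (ω n)).toMeasure) (F (frestrictLe n ω)) hg
  · exact hFg.lintegral_kernel_prod_right'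
  · fun_prop

theorem walkLaw_zero (G : SimpleGraph V) (a : V) (g : V → ℝ≥0∞) :
    ∫⁻ ω, g (ω 0) ∂(walkLaw G a) = g a := by
  have h := Kernel.traj_map_frestrictLe_apply (X := fun _ => V) (κ := historyKernel G) 0 0
    (fun _ => a)
  have hg : Measurable g := measurable_of_countable g
  have hm : Measurable fun x : (Finset.Iic 0 → V) => g (x ⟨0, by simp⟩) :=
    hg.comp (measurable_pi_apply _)
  have h1 : ∫⁻ ω, g (ω 0) ∂(walkLaw G a) = ∫⁻ x, g (x ⟨0, by simp⟩)
      ∂((Kernel.traj (X := fun _ => V) (historyKernel G) 0 (fun _ => a)).map (frestrictLe 0)) := by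
    rw [lintegral_map hm (by fun_prop)]
    rfl
  rw [h1, h, Kernel.partialTraj_self, Kernel.id_apply, lintegral_dirac' _ hm]

theorem measurable_avoids (b : V) (n : ℕ) : Measurable (avoids b n) := by
  obtain ⟨F, hF⟩ := avoids_eq_comp b n
  rw [funext hF]
  exact (measurable_of_countable F).comp (by fun_prop)

end Walk

/-! ### Hitting times from the linear system -/

section Hitting

variable {V : Type*}

/-- `h` solves the linear system characterising the expected hitting times of `b`. -/
structure IsHittingSolution [Fintype V] (G : SimpleGraph V) [DecidableRel G.Adj] (b : V)
    (h : V → ℝ) : Prop where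
  nonneg : ∀ x, 0 ≤ h x
  target : h b = 0
  degree_pos : ∀ x, 0 < G.degree x
  step : ∀ x, x ≠ b → ∑ y ∈ G.neighborFinset x, (h x - h y) = G.degree x

theorem lintegral_stepLaw [Fintype V] [MeasurableSpace V] [DiscreteMeasurableSpace V]
    (G : SimpleGraph V) [DecidableRel G.Adj] (x : V) (hx : 0 < G.degree x) (g : V → ℝ≥0∞) :
    ∫⁻ y, g y ∂(stepLaw G x).toMeasure =
      (∑ y ∈ G.neighborFinset x, g y) * (G.degree x : ℝ≥0∞)⁻¹ := by
  classical
  have hs : (Set.toFinite (G.neighborSet x)).toFinset = G.neighborFinset x := by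
    ext; simp
  have hne : (Set.toFinite (G.neighborSet x)).toFinset.Nonempty := by
    rw [hs, ← Finset.card_pos]; simpa using hx
  rw [lintegral_fintype, Finset.sum_mul]
  simp_rw [PMF.toMeasure_apply_singleton _ _ (MeasurableSet.singleton _)]
  rw [stepLaw, dif_pos hne]
  simp_rw [PMF.uniformOfFinset_apply, hs, mul_ite, mul_zero]
  rw [← Finset.sum_filter]
  refine Finset.sum_congr (by ext; simp) fun y _ => ?_
  simp

theorem IsHittingSolution.lintegral_step [Fintype V] [MeasurableSpace V]
    [DiscreteMeasurableSpace V] {G : SimpleGraph V} [DecidableRel G.Adj] {b : V} {h : V → ℝ}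
    (H : IsHittingSolution G b h) {x : V} (hx : x ≠ b) :
    1 + ∫⁻ y, ENNReal.ofReal (h y) ∂(stepLaw G x).toMeasure = ENNReal.ofReal (h x) := by
  have hd := H.degree_pos x
  have hd' : (0 : ℝ) < G.degree x := by exact_mod_cast hd
  rw [lintegral_stepLaw G x hd, ← ENNReal.ofReal_sum_of_nonneg fun y _ => H.nonneg y,
    ← ENNReal.ofReal_natCast, ← ENNReal.ofReal_inv_of_pos hd', ← ENNReal.ofReal_one,
    ← ENNReal.ofReal_mul (Finset.sum_nonneg fun y _ => H.nonneg y),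
    ← ENNReal.ofReal_add zero_le_one
      (mul_nonneg (Finset.sum_nonneg fun y _ => H.nonneg y) (inv_nonneg.2 hd'.le))]
  congr 1
  have := H.step x hx
  rw [Finset.sum_sub_distrib, Finset.sum_const, nsmul_eq_mul,
    G.card_neighborFinset_eq_degree] at this
  field_simp
  linarith

open Filter Topology in
/-- A nonnegative solution of the linear system is the hitting time. -/
theorem IsHittingSolution.hittingTime_eq [Fintype V] {G : SimpleGraph V} [DecidableRel G.Adj]
    {b : V} {h : V → ℝ} (H : IsHittingSolution G b h) (a : V) :
    hittingTime G a b = ENNReal.ofReal (h a) := by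
  classical
  let hE : V → ℝ≥0∞ := fun x => ENNReal.ofReal (h x)
  let _ : MeasurableSpace V := ⊤
  have hb : hE b = 0 := by simp [hE, H.target]
  let u : ℕ → ℝ≥0∞ := fun n => ∫⁻ ω, avoids b n ω ∂(walkLaw G a)
  let w : ℕ → ℝ≥0∞ := fun n => ∫⁻ ω, avoids b n ω * hE (ω n) ∂(walkLaw G a)
  have hw0 : w 0 = hE a := by
    have : ∀ ω : ℕ → V, avoids b 0 ω * hE (ω 0) = hE (ω 0) := fun ω => by
      by_cases h0 : ω 0 = b
      · simp [h0, hb]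
      · simp [avoids, h0]
    simp only [w, this]
    exact walkLaw_zero G a hE
  -- One step of the walk, on the event that `b` has been avoided so far, costs one unit of time.
  -- The constraint of avoiding `b` at time n + 1 is free because `hE b = 0`.
  have hrec : ∀ n, w n = u n + w (n + 1) := fun n => by
    obtain ⟨F, hF⟩ := avoids_eq_comp b n
    have e1 : w (n + 1) = ∫⁻ ω, avoids b n ω *
        ∫⁻ y, hE y ∂(stepLaw G (ω n)).toMeasure ∂(walkLaw G a) := by
      simp only [w, hF]
      rw [← lintegral_walkLaw_succ]
      refine lintegral_congr fun ω => ?_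
      rw [avoids_succ, hF]
      split_ifs with h0
      · simp [h0, hb]
      · simp
    rw [e1]
    simp only [u, w]
    rw [← lintegral_add_left (measurable_avoids b n)]
    refine lintegral_congr fun ω => ?_
    by_cases h0 : ω n = b
    · have : avoids b n ω = 0 := if_neg fun H => H n le_rfl h0
      simp [this]
    · rw [show hE (ω n) = 1 + ∫⁻ y, hE y ∂(stepLaw G (ω n)).toMeasure from
        (H.lintegral_step h0).symm, mul_add, mul_one]
  have hsum : ∀ N, ∑ n ∈ Finset.range N, u n + w N = hE a := fun N => by
    induction N with
    | zero => simpa using hw0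
    | succ N ih => rw [Finset.sum_range_succ, add_assoc, ← hrec, ih]
  have hle : ∑' n, u n ≤ hE a := ENNReal.tsum_le_of_sum_range_le fun N => by
    rw [← hsum N]; exact le_self_add
  have hfin : ∑' n, u n ≠ ∞ := ne_top_of_le_ne_top ENNReal.ofReal_ne_top hle
  have hu0 : Tendsto u atTop (𝓝 0) := ENNReal.tendsto_atTop_zero_of_tsum_ne_top hfin
  -- A finite bound for `hE`: the remainder `w` is at most `M * u`, and `u` tends to 0 because its
  -- sum is finite.
  let M : ℝ≥0∞ := ∑ x, hE x
  have hM : M ≠ ∞ := ENNReal.sum_ne_top.2 fun x _ => ENNReal.ofReal_ne_top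
  have hwM : ∀ n, w n ≤ M * u n := fun n => by
    simp only [w, u]
    rw [← lintegral_const_mul _ (measurable_avoids b n)]
    refine lintegral_mono fun ω => ?_
    rw [mul_comm]
    gcongr
    exact Finset.single_le_sum (f := hE) (fun _ _ => zero_le) (Finset.mem_univ _)
  have hw : Tendsto w atTop (𝓝 0) := by
    refine tendsto_of_tendsto_of_tendsto_of_le_of_le tendsto_const_nhds ?_
      (fun n => zero_le) hwM
    simpa using ENNReal.Tendsto.const_mul hu0 (Or.inr hM)
  have hlim : Tendsto (fun N => ∑ n ∈ Finset.range N, u n + w N) atTop (𝓝 (∑' n, u n + 0)) :=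
    (ENNReal.tendsto_nat_tsum u).add hw
  have : ∑' n, u n = hE a := by
    simp_rw [hsum] at hlim
    simpa using (tendsto_nhds_unique hlim tendsto_const_nhds)
  have hdef : hittingTime G a b = ∫⁻ ω, firstHit b ω ∂(walkLaw G a) := rfl
  rw [hdef]
  simp_rw [firstHit_eq_tsum]
  rw [lintegral_tsum fun n => (measurable_avoids b n).aemeasurable]
  exact this

end Hitting

/-! ### Green's identity and solvability of the system -/

section EdgeSums

variable {V : Type*}

/-- The sum of the values of `φ` at the two ends of an edge. -/
def edgeAdd (φ : V → ℝ) : Sym2 V → ℝ :=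
  Sym2.lift ⟨fun x y => φ x + φ y, fun _ _ => add_comm _ _⟩

/-- The product of the increments of `φ` and `h` along an edge. -/
def edgeMul (φ h : V → ℝ) : Sym2 V → ℝ :=
  Sym2.lift ⟨fun x y => (φ x - φ y) * (h x - h y), fun _ _ => by ring⟩

@[simp] theorem edgeAdd_mk (φ : V → ℝ) (x y : V) : edgeAdd φ s(x, y) = φ x + φ y := rfl

@[simp] theorem edgeMul_mk (φ h : V → ℝ) (x y : V) :
    edgeMul φ h s(x, y) = (φ x - φ y) * (h x - h y) := rfl

theorem edgeAdd_congr {φ ψ : V → ℝ} {e : Sym2 V} (h : ∀ x ∈ e, φ x = ψ x) :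
    edgeAdd φ e = edgeAdd ψ e := by
  induction e with | _ x y => simp [h x (by simp), h y (by simp)]

theorem edgeMul_congr {φ ψ h : V → ℝ} {e : Sym2 V} (H : ∀ x ∈ e, φ x = ψ x) :
    edgeMul φ h e = edgeMul ψ h e := by
  induction e with | _ x y => simp [H x (by simp), H y (by simp)]

variable [Fintype V] [DecidableEq V] (G : SimpleGraph V) [DecidableRel G.Adj]

theorem sum_neighborFinset_eq_sum_darts (f : V → V → ℝ) :
    ∑ x, ∑ y ∈ G.neighborFinset x, f x y = ∑ d : G.Dart, f d.fst d.snd := by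
  rw [← Finset.sum_fiberwise (s := Finset.univ) (g := fun d : G.Dart => d.fst)]
  refine Finset.sum_congr rfl fun x _ => ?_
  refine Finset.sum_bij' (fun y hy => ⟨(x, y), (G.mem_neighborFinset x y).1 hy⟩)
    (fun d _ => d.snd) ?_ ?_ ?_ ?_ ?_
  · simp
  · intro d hd
    obtain rfl := (Finset.mem_filter.1 hd).2
    simp
  · simp
  · intro d hd
    obtain rfl := (Finset.mem_filter.1 hd).2
    rfl
  · simp

/-- Each edge carries exactly two darts, which are opposite to each other. -/
theorem sum_darts_eq_sum_edges (f : V → V → ℝ) (F : Sym2 V → ℝ)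
    (hF : ∀ x y, F s(x, y) = f x y + f y x) :
    ∑ d : G.Dart, f d.fst d.snd = ∑ e ∈ G.edgeFinset, F e := by
  rw [← Finset.sum_fiberwise_of_maps_to (s := Finset.univ) (t := G.edgeFinset)
    (g := fun d : G.Dart => d.edge) (fun d _ => by simp)]
  refine Finset.sum_congr rfl fun e he => ?_
  induction e with | _ x y =>
  let d : G.Dart := ⟨(x, y), by simpa using he⟩
  have h1 := d.edge_fiber
  have h2 : (Finset.univ.filter fun d' : G.Dart => d'.edge = s(x, y)) = {d, d.symm} := h1
  rw [h2, Finset.sum_pair d.symm_ne.symm, hF]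
  rfl

theorem sum_degree_mul (φ : V → ℝ) :
    ∑ v, (G.degree v : ℝ) * φ v = ∑ e ∈ G.edgeFinset, edgeAdd φ e := by
  rw [← sum_darts_eq_sum_edges G (fun x _ => φ x) _ (fun x y => rfl),
    ← sum_neighborFinset_eq_sum_darts G fun x _ => φ x]
  simp

theorem sum_mul_laplacian (φ h : V → ℝ) :
    ∑ x, φ x * ∑ y ∈ G.neighborFinset x, (h x - h y) =
      ∑ e ∈ G.edgeFinset, edgeMul φ h e := by
  rw [← sum_darts_eq_sum_edges G (fun x y => φ x * (h x - h y)) _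
    (fun x y => by rw [edgeMul_mk]; ring),
    ← sum_neighborFinset_eq_sum_darts G fun x y => φ x * (h x - h y)]
  simp only [Finset.mul_sum]

variable {G}

/-- Summation by parts; the vanishing of φ at `b` removes the only vertex where the equation is not
imposed. -/
theorem IsHittingSolution.sum_degree_mul {b : V} {h : V → ℝ} (H : IsHittingSolution G b h)
    {φ : V → ℝ} (hφ : φ b = 0) :
    ∑ e ∈ G.edgeFinset, edgeMul φ h e = ∑ e ∈ G.edgeFinset, edgeAdd φ e := by
  rw [← sum_mul_laplacian, ← UnicyclicHitting.sum_degree_mul]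
  refine Finset.sum_congr rfl fun x _ => ?_
  by_cases hx : x = b
  · simp [hx, hφ]
  · rw [H.step x hx, mul_comm]

/-- The system is square, so uniqueness gives existence. A homogeneous solution has zero Dirichlet
energy, hence is constant by connectedness, hence zero. -/
theorem exists_isHittingSolution (hG : G.Connected) [Nontrivial V] (b : V) :
    ∃ h, IsHittingSolution G b h := by
  have hdeg : ∀ x, 0 < G.degree x := fun x => hG.preconnected.degree_pos_of_nontrivial x
  let T : (V → ℝ) →ₗ[ℝ] (V → ℝ) :=
    { toFun := fun f x => if x = b then f b else ∑ y ∈ G.neighborFinset x, (f x - f y)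
      map_add' := fun f g => by
        ext x
        simp only [Pi.add_apply]
        split_ifs
        · rfl
        · rw [← Finset.sum_add_distrib]
          exact Finset.sum_congr rfl fun y _ => by ring
      map_smul' := fun c f => by
        ext x
        simp only [Pi.smul_apply, smul_eq_mul, RingHom.id_apply]
        split_ifs
        · rfl
        · rw [Finset.mul_sum]
          exact Finset.sum_congr rfl fun y _ => by ring }
  have hT : ∀ f x, T f x = if x = b then f b else ∑ y ∈ G.neighborFinset x, (f x - f y) :=
    fun _ _ => rfl
  have hinj : Function.Injective T := by
    refine (injective_iff_map_eq_zero T).2 fun f hf => ?_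
    have hb : f b = 0 := by simpa [hT] using congrFun hf b
    have hsum : ∑ e ∈ G.edgeFinset, edgeMul f f e = 0 := by
      rw [← sum_mul_laplacian]
      refine Finset.sum_eq_zero fun x _ => ?_
      by_cases hx : x = b
      · simp [hx, hb]
      · have := congrFun hf x
        rw [hT, if_neg hx] at this
        simp [this]
    have hz := (Finset.sum_eq_zero_iff_of_nonneg fun e _ => by
      induction e with | _ x y => exact mul_self_nonneg (f x - f y)).1 hsum
    have hadj : ∀ x y, G.Adj x y → f x = f y := fun x y hxy => by
      have := hz s(x, y) (by simpa using hxy)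
      rw [edgeMul_mk, mul_self_eq_zero] at this
      linarith
    ext x
    obtain ⟨p⟩ := hG.preconnected x b
    have : ∀ {u v : V} (p : G.Walk u v), f u = f v := fun p => by
      induction p with
      | nil => rfl
      | cons e _ ih => rw [hadj _ _ e, ih]
    simp [this p, hb]
  obtain ⟨h, hh⟩ := (LinearMap.injective_iff_surjective.1 hinj)
    (fun x => if x = b then 0 else (G.degree x : ℝ))
  have hb : h b = 0 := by simpa [hT] using congrFun hh b
  have hstep : ∀ x, x ≠ b → ∑ y ∈ G.neighborFinset x, (h x - h y) = G.degree x := fun x hx => by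
    simpa [hT, hx] using congrFun hh x
  refine ⟨h, ?_, hb, hdeg, hstep⟩
  -- Minimum principle: at a minimum other than `b` the left side of the equation would be
  -- nonpositive, while the degree is positive.
  obtain ⟨x₀, hx₀⟩ := Finite.exists_min h
  have h0 : 0 ≤ h x₀ := by
    by_cases hx : x₀ = b
    · rw [hx, hb]
    · have h1 : (0 : ℝ) < G.degree x₀ := by exact_mod_cast hdeg x₀
      rw [← hstep x₀ hx] at h1
      exact absurd h1 (not_lt.2 (Finset.sum_nonpos fun y _ => sub_nonpos.2 (hx₀ y)))
  exact fun x => h0.trans (hx₀ x)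

end EdgeSums

/-! ### Edge sums along a walk with affine potential -/

section WalkSums

variable {V : Type*} {G : SimpleGraph V}

/-- `φ` is affine with slope `c` along the walk `p`, as a function of the remaining length. -/
def AffineAlong (φ : V → ℝ) (β c : ℝ) {x y : V} (p : G.Walk x y) : Prop :=
  ∀ (v : V) (p₁ : G.Walk x v) (p₂ : G.Walk v y), p₁.append p₂ = p → φ v = β + c * p₂.length

theorem AffineAlong.of_cons {φ : V → ℝ} {β c : ℝ} {x y z : V} {e : G.Adj x y} {p : G.Walk y z}
    (h : AffineAlong φ β c (.cons e p)) : AffineAlong φ β c p :=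
  fun v p₁ p₂ hp => h v (.cons e p₁) p₂ (by simp [hp])

theorem AffineAlong.start {φ : V → ℝ} {β c : ℝ} {x y : V} {p : G.Walk x y}
    (h : AffineAlong φ β c p) : φ x = β + c * p.length :=
  h x .nil p rfl

theorem AffineAlong.sum_edgeMul {φ : V → ℝ} {β c : ℝ} {x y : V} {p : G.Walk x y}
    (h : AffineAlong φ β c p) (g : V → ℝ) :
    (p.edges.map (edgeMul φ g)).sum = c * (g x - g y) := by
  induction p with
  | nil => simp
  | cons e p ih =>
    have h1 := h.start
    have h2 := h.of_cons.start
    rw [SimpleGraph.Walk.edges_cons, List.map_cons, List.sum_cons, ih h.of_cons, edgeMul_mk, h1, h2,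
      SimpleGraph.Walk.length_cons]
    push_cast
    ring

theorem AffineAlong.sum_edgeAdd {φ : V → ℝ} {β c : ℝ} {x y : V} {p : G.Walk x y}
    (h : AffineAlong φ β c p) :
    (p.edges.map (edgeAdd φ)).sum = p.length * (2 * β + c * p.length) := by
  induction p with
  | nil => simp
  | cons e p ih =>
    have h1 := h.start
    have h2 := h.of_cons.start
    rw [SimpleGraph.Walk.edges_cons, List.map_cons, List.sum_cons, ih h.of_cons, edgeAdd_mk, h1, h2,
      SimpleGraph.Walk.length_cons]
    push_cast
    ring

end WalkSums

/-! ### Green's identity reduced to a core subgraph -/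

section Components

variable {V : Type*} {G : SimpleGraph V}

/-- Follow a walk from `v` to S: before it first uses an edge of K it stands on a vertex of K. -/
theorem exists_reachable_deleteEdges (hG : G.Connected) (K : G.Subgraph) {S : Set V}
    (hS : K.verts ⊆ S) (hne : S.Nonempty) (v : V) :
    ∃ w ∈ S, (G.deleteEdges K.edgeSet).Reachable w v := by
  obtain ⟨w₀, hw₀⟩ := hne
  obtain ⟨p⟩ := hG.preconnected v w₀
  induction p with
  | nil => exact ⟨_, hw₀, .refl _⟩
  | @cons x y z e p ih =>
    by_cases he : s(x, y) ∈ K.edgeSet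
    · exact ⟨x, hS (K.edge_vert he), .refl _⟩
    · obtain ⟨w, hw, hr⟩ := ih hw₀
      refine ⟨w, hw, hr.trans (SimpleGraph.Adj.reachable ?_)⟩
      rw [SimpleGraph.deleteEdges_adj]
      exact ⟨e.symm, by rwa [Sym2.eq_swap]⟩

/-- Green's identity for the hitting times and a potential that is constant on the components of
the complement of a subgraph `K`, each of which contains exactly one vertex of `K`. -/
theorem IsHittingSolution.sum_edges_eq [Fintype V] [DecidableEq V] [DecidableRel G.Adj]
    (hG : G.Connected) {b : V} {h : V → ℝ} (H : IsHittingSolution G b h) (K : G.Subgraph)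
    (S : Finset V) (hS : K.verts = S) (hb : b ∈ S)
    (hsep : ∀ x ∈ S, ∀ y ∈ S, (G.deleteEdges K.edgeSet).Reachable x y → x = y)
    (E : List (Sym2 V)) (hE : E.Nodup) (hEK : ∀ e, e ∈ E ↔ e ∈ K.edgeSet)
    (φ : V → ℝ) (hφ : φ b = 0) :
    (E.map (edgeMul φ h)).sum =
      (E.map (edgeAdd φ)).sum + 2 * ∑ w ∈ S, (componentEdgeCount G K w : ℝ) * φ w := by
  classical
  have hcover := exists_reachable_deleteEdges hG K hS.le ⟨b, by exact_mod_cast hb⟩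
  -- `r` sends each vertex to the root of its branch. The identity is applied to φ ∘ r, which agrees
  -- with φ on the edges of K and is constant on every branch.
  choose r hrS hr using hcover
  have hrS' : ∀ v, r v ∈ S := fun v => by exact_mod_cast hrS v
  have hrr : ∀ w ∈ S, r w = w := fun w hw => hsep _ (hrS' w) _ hw (hr w)
  have hreach : ∀ u v, (G.deleteEdges K.edgeSet).Reachable u v → r u = r v := fun u v huv =>
    hsep _ (hrS' u) _ (hrS' v) (((hr u).trans huv).trans (hr v).symm)
  have hEV : ∀ e ∈ E, ∀ x ∈ e, φ (r x) = φ x := fun e he x hx => by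
    rw [hrr]
    have := K.mem_verts_of_mem_edge ((hEK e).1 he) hx
    rw [hS] at this
    exact_mod_cast this
  have hfilter : G.edgeFinset.filter (· ∈ K.edgeSet) = E.toFinset := by
    ext e
    simp only [Finset.mem_filter, SimpleGraph.mem_edgeFinset, List.mem_toFinset, hEK]
    exact and_iff_right_of_imp fun he => K.edgeSet_subset he
  have hedge : ∀ e ∈ G.edgeFinset.filter (· ∉ K.edgeSet), ∀ x ∈ e, ∀ y ∈ e, r x = r y := by
    intro e he x hx y hy
    simp only [Finset.mem_filter, SimpleGraph.mem_edgeFinset] at he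
    by_cases hxy : x = y
    · rw [hxy]
    · obtain rfl : e = s(x, y) := ((Sym2.mem_and_mem_iff hxy).1 ⟨hx, hy⟩)
      exact hreach _ _ (SimpleGraph.Adj.reachable (by
        rw [SimpleGraph.deleteEdges_adj]; exact he))
  have key := H.sum_degree_mul (φ := fun v => φ (r v)) (by simp only [hrr b hb, hφ])
  rw [← Finset.sum_filter_add_sum_filter_not G.edgeFinset (· ∈ K.edgeSet),
    ← Finset.sum_filter_add_sum_filter_not G.edgeFinset (· ∈ K.edgeSet), hfilter,
    List.sum_toFinset _ hE, List.sum_toFinset _ hE] at key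
  have h1 : E.map (edgeMul (fun v => φ (r v)) h) = E.map (edgeMul φ h) :=
    List.map_congr_left fun e he => edgeMul_congr (hEV e he)
  have h2 : E.map (edgeAdd fun v => φ (r v)) = E.map (edgeAdd φ) :=
    List.map_congr_left fun e he => edgeAdd_congr (hEV e he)
  have h3 : ∑ e ∈ G.edgeFinset.filter (· ∉ K.edgeSet), edgeMul (fun v => φ (r v)) h e = 0 := by
    refine Finset.sum_eq_zero fun e he => ?_
    have := hedge e he
    induction e with | _ x y =>
    simp [this x (by simp) y (by simp)]
  have h4 : ∑ e ∈ G.edgeFinset.filter (· ∉ K.edgeSet), edgeAdd (fun v => φ (r v)) e =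
      2 * ∑ w ∈ S, (componentEdgeCount G K w : ℝ) * φ w := by
    -- Edges off K are grouped by root. Both ends of such an edge have the same root, so the choice
    -- of end is immaterial.
    rw [← Finset.sum_fiberwise_of_maps_to (t := S) (g := fun e => r e.out.1)
      (fun e _ => hrS' _), Finset.mul_sum]
    refine Finset.sum_congr rfl fun w hw => ?_
    have hcard : componentEdgeCount G K w =
        ((G.edgeFinset.filter (· ∉ K.edgeSet)).filter fun e => r e.out.1 = w).card := by
      rw [componentEdgeCount, ← Set.ncard_coe_finset]
      congr 1
      ext e
      simp only [componentVerts, Set.mem_ofPred_eq, Finset.coe_filter, Finset.mem_filter,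
        SimpleGraph.mem_edgeFinset, SimpleGraph.edgeSet_deleteEdges, Set.mem_sdiff]
      refine and_congr_right fun he => ⟨fun hu => ?_, fun hu x hx => ?_⟩
      · rw [← hreach _ _ (hu _ e.out_fst_mem), hrr w hw]
      · rw [← hu, hedge e (by simpa using he) _ e.out_fst_mem x hx]
        exact hr x
    have hval : ∀ e ∈ (G.edgeFinset.filter (· ∉ K.edgeSet)).filter fun e => r e.out.1 = w,
        edgeAdd (fun v => φ (r v)) e = 2 * φ w := fun e he => by
      obtain ⟨he, hw⟩ := Finset.mem_filter.1 he
      have h5 : ∀ x ∈ e, φ (r x) = φ w := fun x hx => by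
        rw [← hw, hedge e he x hx _ e.out_fst_mem]
      rw [edgeAdd_congr (ψ := fun _ => φ w) h5]
      induction e with | _ x y => simp [two_mul]
    rw [Finset.sum_congr rfl hval, Finset.sum_const, ← hcard, nsmul_eq_mul]
    ring
  rw [h1, h2, h3, h4, add_zero] at key
  exact key

end Components

open SimpleGraph

/-! ### Paths made of bridges -/

section Bridges

variable {V : Type*} {G : SimpleGraph V}

/-- Any walk across a bridge's two sides uses the bridge, so `q` contains the first edge of `p`;
being a path, it must start with it. -/
theorem isPath_eq_of_isBridge {a b : V} (p q : G.Walk a b) (hp : p.IsPath) (hq : q.IsPath)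
    (hb : ∀ e ∈ p.edges, G.IsBridge e) : q = p := by
  induction p with
  | nil => exact Walk.isPath_iff_nil.1 hq |>.eq_nil
  | @cons a y b e p ih =>
    obtain ⟨hp', ha⟩ := (Walk.cons_isPath_iff _ _).1 hp
    have hq' : s(a, y) ∈ q.edges := by
      have := isBridge_iff_forall_walk_mem_edges.1 (hb s(a, y) (by simp)) (q.append p.reverse)
      rw [Walk.edges_append, List.mem_append, Walk.edges_reverse, List.mem_reverse] at this
      exact this.resolve_right fun h => ha (p.fst_mem_support_of_mem_edges h)
    cases q with
    | nil => exact absurd p.end_mem_support ha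
    | @cons _ z _ e' q =>
      obtain ⟨hq1, haq⟩ := (Walk.cons_isPath_iff _ _).1 hq
      have hyz : y = z := by
        rw [Walk.edges_cons, List.mem_cons] at hq'
        rcases hq' with h | h
        · exact Sym2.congr_right.1 h
        · exact absurd (q.fst_mem_support_of_mem_edges h) haq
      subst hyz
      rw [ih q hp' hq1 fun e he => hb e (by simp [he])]

theorem dist_eq_length_of_isBridge {a b : V} (p : G.Walk a b) (hp : p.IsPath)
    (hb : ∀ e ∈ p.edges, G.IsBridge e) : G.dist a b = p.length := by
  obtain ⟨q, hq, hl⟩ := Reachable.exists_path_of_dist ⟨p⟩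
  rw [← hl, isPath_eq_of_isBridge p q hp hq hb]

theorem affineAlong_of_isBridge {φ : V → ℝ} {β : ℝ} {a b : V} (p : G.Walk a b) (hp : p.IsPath)
    (hb : ∀ e ∈ p.edges, G.IsBridge e) (hφ : ∀ v ∈ p.support, φ v = β + G.dist v b) :
    AffineAlong φ β 1 p := by
  rintro v p₁ p₂ rfl
  rw [hφ v (by simp), dist_eq_length_of_isBridge p₂ hp.of_append_right
    fun e he => hb e (by simp [he]), one_mul]

theorem eq_of_walk_avoiding_path {a b : V} (p : G.Walk a b) (hp : p.IsPath)
    (hb : ∀ e ∈ p.edges, G.IsBridge e) {x y : V} (hx : x ∈ p.support) (hy : y ∈ p.support)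
    (q : G.Walk x y) (hq : ∀ e ∈ q.edges, e ∉ p.edges) : x = y := by
  classical
  induction p with
  | nil => simp_all
  | @cons a z b e p ih =>
    obtain ⟨hp', ha⟩ := (Walk.cons_isPath_iff _ _).1 hp
    have key : ∀ w ∈ p.support, ∀ q : G.Walk a w, s(a, z) ∈ q.edges := fun w hw q => by
      have := isBridge_iff_forall_walk_mem_edges.1 (hb s(a, z) (by simp))
        (q.append (p.takeUntil w hw).reverse)
      rw [Walk.edges_append, List.mem_append, Walk.edges_reverse, List.mem_reverse] at this
      exact this.resolve_right fun h =>
        ha (p.fst_mem_support_of_mem_edges (p.edges_takeUntil_subset_edges hw h))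
    rw [Walk.support_cons, List.mem_cons] at hx hy
    rcases hx with rfl | hx <;> rcases hy with rfl | hy
    · rfl
    · exact absurd (by simp) (hq _ (key _ hy q))
    · have h := key _ hx q.reverse
      rw [Walk.edges_reverse, List.mem_reverse] at h
      exact absurd (by simp) (hq _ h)
    · exact ih hp' (fun e he => hb e (by simp [he])) hx hy fun e he h => hq e he (by simp [h])

theorem notMem_of_mem_edges_deleteEdges {S : Set (Sym2 V)} {x y : V}
    (p : (G.deleteEdges S).Walk x y) {e : Sym2 V} (he : e ∈ p.edges) : e ∉ S := by
  have := p.edges_subset_edgeSet he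
  rw [edgeSet_deleteEdges] at this
  exact this.2

theorem exists_walk_of_reachable_deleteEdges {S : Set (Sym2 V)} {x y : V}
    (h : (G.deleteEdges S).Reachable x y) :
    ∃ p : G.Walk x y, p.IsPath ∧ ∀ e ∈ p.edges, e ∉ S := by
  obtain ⟨p, hp⟩ := h.exists_isPath
  refine ⟨p.mapLe (G.deleteEdges_le S), (Walk.isPath_mapLe _).2 hp, fun e he => ?_⟩
  rw [Walk.edges_mapLe_eq_edges] at he
  exact notMem_of_mem_edges_deleteEdges p he

end Bridges

/-! ### Branches and arcs in a unicyclic graph -/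

section Unicyclic

variable {V : Type*} {G : SimpleGraph V} {C : G.Subgraph}

theorem IsUnicyclicWith.isBridge (hG : IsUnicyclicWith G C) {e : Sym2 V} (he : e ∈ G.edgeSet)
    (heC : e ∉ C.edgeSet) : G.IsBridge e := by
  refine (isBridge_iff_forall_cycle_notMem he).2 fun u c hc hec => heC ?_
  rw [← hG.unique _ ⟨u, c, hc, rfl⟩]
  exact (Walk.mem_edges_toSubgraph c).2 hec

theorem IsUnicyclicWith.connected_cycle (hG : IsUnicyclicWith G C) : C.Connected := by
  obtain ⟨v, c, -, rfl⟩ := hG.isCycle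
  exact c.toSubgraph_connected

theorem exists_walk_of_connected {K : G.Subgraph} (hK : K.Connected) {x y : V} (hx : x ∈ K.verts)
    (hy : y ∈ K.verts) : ∃ p : G.Walk x y, ∀ e ∈ p.edges, e ∈ K.edgeSet := by
  obtain ⟨p, hp⟩ := (K.connected_iff_forall_exists_walk_subgraph.1 hK).2 hx hy
  exact ⟨p, fun e he => Subgraph.edgeSet_mono hp ((Walk.mem_edges_toSubgraph p).2 he)⟩

/-- A nontrivial path leaving K would begin with a bridge, yet its remainder and a walk inside K
join the ends of that bridge without using it. -/
theorem IsUnicyclicWith.eq_of_reachable (hG : IsUnicyclicWith G C) {K : G.Subgraph}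
    (hK : K.Connected) (hCK : C ≤ K) {x y : V} (hx : x ∈ K.verts) (hy : y ∈ K.verts)
    (h : (G.deleteEdges K.edgeSet).Reachable x y) : x = y := by
  obtain ⟨p, hp, hpK⟩ := exists_walk_of_reachable_deleteEdges h
  cases p with
  | nil => rfl
  | @cons _ z _ e p =>
    obtain ⟨-, hxp⟩ := (Walk.cons_isPath_iff _ _).1 hp
    have heK : s(x, z) ∉ K.edgeSet := hpK _ (by simp)
    have hbr := hG.isBridge (e := s(x, z)) e fun h => heK (Subgraph.edgeSet_mono hCK h)
    obtain ⟨q, hq⟩ := exists_walk_of_connected hK hx hy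
    have := isBridge_iff_forall_walk_mem_edges.1 hbr (q.append p.reverse)
    rw [Walk.edges_append, List.mem_append, Walk.edges_reverse, List.mem_reverse] at this
    rcases this with h | h
    · exact absurd (hq _ h) heK
    · exact absurd (p.fst_mem_support_of_mem_edges h) hxp

theorem IsUnicyclicWith.notMem_cycle_of_path (hG : IsUnicyclicWith G C) {a b : V}
    (h : (G.deleteEdges C.edgeSet).Reachable a b) (p : G.Walk a b) (hp : p.IsPath) :
    ∀ e ∈ p.edges, e ∉ C.edgeSet := by
  obtain ⟨q, hq, hqC⟩ := exists_walk_of_reachable_deleteEdges h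
  rwa [isPath_eq_of_isBridge q p hq hp
    fun e he => hG.isBridge (q.edges_subset_edgeSet he) (hqC e he)]

theorem reachable_deleteEdges_of_mem_support {S : Set (Sym2 V)} {a b v : V} (p : G.Walk a b)
    (hp : ∀ e ∈ p.edges, e ∉ S) (hv : v ∈ p.support) : (G.deleteEdges S).Reachable a v := by
  classical
  exact ⟨(p.takeUntil v hv).toDeleteEdges S
    fun e he => hp e (p.edges_takeUntil_subset_edges hv he)⟩

/-- Deleting one edge of the only cycle leaves an acyclic graph. -/
theorem IsUnicyclicWith.path_unique (hG : IsUnicyclicWith G C) {e : Sym2 V} (he : e ∈ C.edgeSet)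
    {x y : V} {p q : G.Walk x y} (hp : p.IsPath) (hq : q.IsPath) (hep : e ∉ p.edges)
    (heq : e ∉ q.edges) : p = q := by
  have hac : (G.deleteEdges {e}).IsAcyclic := fun v c hc => by
    have hc' := hc.mapLe (G.deleteEdges_le {e})
    rw [← hG.unique _ ⟨v, _, hc', rfl⟩, Walk.mem_edges_toSubgraph,
      Walk.edges_mapLe_eq_edges] at he
    exact notMem_of_mem_edges_deleteEdges c he rfl
  have hp' : ∀ f ∈ p.edges, f ∉ ({e} : Set (Sym2 V)) := fun f hf h => hep (h ▸ hf)
  have hq' : ∀ f ∈ q.edges, f ∉ ({e} : Set (Sym2 V)) := fun f hf h => heq (h ▸ hf)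
  have := (hac.subsingleton_path x y).elim ⟨_, Walk.IsPath.toDeleteEdges G {e} hp hp'⟩
    ⟨_, Walk.IsPath.toDeleteEdges G {e} hq hq'⟩
  rw [← Walk.map_toDeleteEdges_eq {e} hp', ← Walk.map_toDeleteEdges_eq {e} hq']
  exact congrArg (Walk.map _) (congrArg Subtype.val this)

/-- `A` and `B` are the two arcs of the cycle `C` between `i` and `j`. -/
structure IsArcs (C : G.Subgraph) {i j : V} (A B : G.Walk i j) : Prop where
  ne : i ≠ j
  left : A.IsPath
  right : B.IsPath
  nodup : (A.edges ++ B.edges).Nodup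
  mem_edges : ∀ e, e ∈ C.edgeSet ↔ e ∈ A.edges ∨ e ∈ B.edges
  mem_verts : ∀ v, v ∈ C.verts ↔ v ∈ A.support ∨ v ∈ B.support
  inter : ∀ v, v ∈ A.support → v ∈ B.support → v = i ∨ v = j

theorem IsArcs.symm {i j : V} {A B : G.Walk i j} (h : IsArcs C A B) : IsArcs C B A where
  ne := h.ne
  left := h.right
  right := h.left
  nodup := List.nodup_append_comm.1 h.nodup
  mem_edges e := (h.mem_edges e).trans or_comm
  mem_verts v := (h.mem_verts v).trans or_comm
  inter v hA hB := h.inter v hB hA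

theorem IsArcs.disjoint {i j : V} {A B : G.Walk i j} (h : IsArcs C A B) {e : Sym2 V}
    (hA : e ∈ A.edges) : e ∉ B.edges := fun hB => List.disjoint_of_nodup_append h.nodup hA hB

theorem IsArcs.ncard {i j : V} {A B : G.Walk i j} (h : IsArcs C A B) :
    C.edgeSet.ncard = A.length + B.length := by
  classical
  have : C.edgeSet = ((A.edges ++ B.edges).toFinset : Set (Sym2 V)) := by
    ext e; simp [h.mem_edges]
  rw [this, Set.ncard_coe_finset, List.toFinset_card_of_nodup h.nodup]
  simp

theorem IsArcs.length_pos {i j : V} {A B : G.Walk i j} (h : IsArcs C A B) : 0 < A.length :=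
  Nat.pos_of_ne_zero fun h0 => h.ne (Walk.eq_of_length_eq_zero h0)

/-- Rotate the cycle to start at `i`, cut it at `j`, and reverse the second half. -/
theorem exists_isArcs (hC : IsCycleIn G C) {i j : V} (hi : i ∈ C.verts) (hj : j ∈ C.verts)
    (hij : i ≠ j) : ∃ A B : G.Walk i j, IsArcs C A B := by
  classical
  obtain ⟨v, c, hc, rfl⟩ := hC
  rw [Walk.mem_verts_toSubgraph] at hi hj
  have hj' : j ∈ (c.rotate i hi).support := by simpa using hj
  have hc' : (c.rotate i hi).IsCycle := (Walk.isCycle_rotate hi).2 hc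
  rw [← Walk.toSubgraph_rotate c hi]
  obtain ⟨A, D, hAD⟩ : ∃ (A : G.Walk i j) (D : G.Walk j i), A.append D = c.rotate i hi :=
    ⟨_, _, Walk.take_spec _ hj'⟩
  rw [← hAD] at hc' ⊢
  have hA : ¬ A.Nil := fun h => hij h.eq
  have hD : ¬ D.Nil := fun h => hij h.eq.symm
  refine ⟨A, D.reverse, hij, hc'.isPath_of_append_left hD, (hc'.isPath_of_append_right hA).reverse,
    ?_, fun e => ?_, fun v => ?_, fun v hvA hvD => ?_⟩
  · have := hc'.edges_nodup
    rw [Walk.edges_append, List.nodup_append'] at this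
    rw [Walk.edges_reverse, List.nodup_append']
    exact ⟨this.1, List.nodup_reverse.2 this.2.1, List.disjoint_reverse_right.2 this.2.2⟩
  · rw [Walk.mem_edges_toSubgraph, Walk.edges_append, List.mem_append, Walk.edges_reverse,
      List.mem_reverse]
  · rw [Walk.mem_verts_toSubgraph, Walk.mem_support_append_iff, Walk.support_reverse,
      List.mem_reverse]
  · have := hc'.support_nodup
    rw [Walk.tail_support_append, List.nodup_append'] at this
    rw [Walk.support_reverse, List.mem_reverse] at hvD
    rw [Walk.mem_support_iff] at hvA hvD
    rcases hvA with h | h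
    · exact .inl h
    rcases hvD with h' | h'
    · exact .inr h'
    · exact absurd h' (this.2.2 h)

theorem IsUnicyclicWith.eq_arc (hG : IsUnicyclicWith G C) {i j : V} {A B : G.Walk i j}
    (h : IsArcs C A B) {W : G.Walk i j} (hW : W.IsPath) {e : Sym2 V} (he : e ∈ C.edgeSet)
    (heW : e ∉ W.edges) : W = A ∨ W = B := by
  rcases (h.mem_edges e).1 he with hA | hB
  · exact .inr (hG.path_unique he hW h.right heW (h.disjoint hA))
  · exact .inl (hG.path_unique he hW h.left heW (h.symm.disjoint hB))

theorem IsUnicyclicWith.dist_arcs (hG : IsUnicyclicWith G C) {i j : V} {A B : G.Walk i j}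
    (h : IsArcs C A B) : G.dist i j = A.length ∨ G.dist i j = B.length := by
  obtain ⟨W, hW, hl⟩ := Reachable.exists_path_of_dist (hG.connected.preconnected i j)
  obtain ⟨e, he, heW⟩ : ∃ e ∈ C.edgeSet, e ∉ W.edges := by
    -- A geodesic through every edge of C would have length at least |A| + |B| > |A|.
    by_contra! hall
    have hsub : (A.edges ++ B.edges).Subperm W.edges := h.nodup.subperm fun e he =>
      hall e ((h.mem_edges e).2 (by simpa using he))
    have h1 := hsub.length_le
    have h2 := dist_le A
    have h3 := h.symm.length_pos
    simp only [List.length_append, Walk.length_edges] at h1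
    omega
  rw [← hl]
  rcases hG.eq_arc h hW he heW with rfl | rfl
  exacts [.inl rfl, .inr rfl]

/-- Both `p` and `B` avoid `k`, hence an edge of C at `k`, so they coincide. Then `q` and the
reversed `A₂` both avoid the edges of `B`, so they coincide too. -/
theorem IsUnicyclicWith.arc_unique (hG : IsUnicyclicWith G C) {i j k : V} {A₁ : G.Walk i k}
    {A₂ : G.Walk k j} {B : G.Walk i j} (h : IsArcs C (A₁.append A₂) B) (hi : k ≠ i) (hj : k ≠ j)
    {p : G.Walk i j} {q : G.Walk j k} (hpq : (p.append q).IsPath) : p = B ∧ q = A₂.reverse := by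
  have hkp : k ∉ p.support := fun hk => by
    have hnd := (Walk.isPath_def _).1 hpq
    rw [Walk.support_append, List.nodup_append'] at hnd
    refine hnd.2.2 hk ?_
    have := q.end_mem_support
    rw [Walk.mem_support_iff] at this
    exact this.resolve_left hj
  have hkB : k ∉ B.support := fun hk => (h.inter k (by simp) hk).elim hi hj
  have hpB : p = B := by
    cases A₂ with
    | nil => exact absurd rfl hj
    | @cons _ y _ e A₂ =>
      exact hG.path_unique (e := s(k, y)) ((h.mem_edges _).2 (.inl (by simp))) hpq.of_append_left
        h.right (fun he => hkp (p.fst_mem_support_of_mem_edges he))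
        (fun he => hkB (B.fst_mem_support_of_mem_edges he))
  subst hpB
  refine ⟨rfl, ?_⟩
  have hpos := h.symm.length_pos
  rw [← Walk.length_edges] at hpos
  obtain ⟨e, he⟩ := List.exists_mem_of_length_pos hpos
  refine hG.path_unique ((h.mem_edges e).2 (.inr he)) hpq.of_append_right
    h.left.of_append_right.reverse (fun heq => ?_) fun heA => ?_
  · have := hpq.isTrail.edges_nodup
    rw [Walk.edges_append] at this
    exact List.disjoint_of_nodup_append this he heq
  · refine h.symm.disjoint he ?_
    rw [Walk.edges_reverse, List.mem_reverse] at heA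
    simp [heA]

theorem IsArcs.isPath_append {i j k : V} {A₁ : G.Walk i k} {A₂ : G.Walk k j} {B : G.Walk i j}
    (h : IsArcs C (A₁.append A₂) B) (hi : k ≠ i) : (B.append A₂.reverse).IsPath := by
  rw [Walk.isPath_def, Walk.support_append, List.nodup_append']
  refine ⟨(Walk.isPath_def _).1 h.right,
    ((Walk.isPath_def _).1 h.left.of_append_right.reverse).tail, fun x hxB hxA => ?_⟩
  have hxA₂ : x ∈ A₂.support := by
    have := List.mem_of_mem_tail hxA
    rwa [Walk.support_reverse, List.mem_reverse] at this
  rcases h.inter x (by simp [hxA₂]) hxB with rfl | rfl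
  · have hnd := (Walk.isPath_def _).1 h.left
    rw [Walk.support_append, List.nodup_append'] at hnd
    refine hnd.2.2 A₁.start_mem_support ?_
    rw [Walk.mem_support_iff] at hxA₂
    exact hxA₂.resolve_left hi.symm
  · have hnd := (Walk.isPath_def _).1 h.left.of_append_right.reverse
    rw [← Walk.cons_tail_support, List.nodup_cons] at hnd
    exact hnd.1 hxA

theorem IsArcs.toSubgraph_append_le {i j k : V} {A₁ : G.Walk i k} {A₂ : G.Walk k j}
    {B : G.Walk i j} (h : IsArcs C (A₁.append A₂) B) : (B.append A₂.reverse).toSubgraph ≤ C := by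
  refine (Walk.toSubgraph_le_iff ?_).2 fun e he => (h.mem_edges e).2 ?_
  · intro hn
    have := h.symm.length_pos
    have h0 := Walk.length_eq_zero_iff.2 hn
    rw [Walk.length_append] at h0
    omega
  · have he' : e ∈ (B.append A₂.reverse).edges := he
    simp only [Walk.edges_append, Walk.edges_reverse, List.mem_append, List.mem_reverse] at he' ⊢
    tauto

theorem IsUnicyclicWith.arcLength (hG : IsUnicyclicWith G C) {i j k : V} {A₁ : G.Walk i k}
    {A₂ : G.Walk k j} {B : G.Walk i j} (h : IsArcs C (A₁.append A₂) B) (hi : k ≠ i) (hj : k ≠ j) :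
    firstArcLength C i j k = B.length ∧ secondArcLength C i j k = A₂.length := by
  constructor
  · rw [firstArcLength, show {n | ∃ (p : G.Walk i j) (q : G.Walk j k), (p.append q).IsPath ∧
      (p.append q).toSubgraph ≤ C ∧ p.length = n} = {B.length} from ?_, csInf_singleton]
    refine Set.eq_singleton_iff_unique_mem.2 ⟨⟨B, A₂.reverse, h.isPath_append hi,
      h.toSubgraph_append_le, rfl⟩, ?_⟩
    rintro n ⟨p, q, hpq, -, rfl⟩
    rw [(hG.arc_unique h hi hj hpq).1]
  · rw [secondArcLength, show {n | ∃ (p : G.Walk i j) (q : G.Walk j k), (p.append q).IsPath ∧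
      (p.append q).toSubgraph ≤ C ∧ q.length = n} = {A₂.length} from ?_, csInf_singleton]
    refine Set.eq_singleton_iff_unique_mem.2 ⟨⟨B, A₂.reverse, h.isPath_append hi,
      h.toSubgraph_append_le, by simp⟩, ?_⟩
    rintro n ⟨p, q, hpq, -, rfl⟩
    rw [(hG.arc_unique h hi hj hpq).2, Walk.length_reverse]

/-- Inducing adds no chord: an extra edge would be a bridge whose ends are already joined inside K.
-/
theorem IsUnicyclicWith.eq_coreSubgraph (hG : IsUnicyclicWith G C) {a i j b : V} (p : G.Walk a i)
    (q : G.Walk j b) {K : G.Subgraph} (hK : K.Connected) (hCK : C ≤ K)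
    (hKv : K.verts = {v | v ∈ p.support} ∪ {v | v ∈ q.support} ∪ C.verts) :
    coreSubgraph C p q = K := by
  refine Subgraph.ext (by rw [coreSubgraph, hKv]; rfl) ?_
  ext x y
  simp only [coreSubgraph, Subgraph.induce_adj, Subgraph.top_adj, ← hKv]
  refine ⟨fun ⟨hx, hy, hxy⟩ => ?_, fun h => ⟨h.fst_mem, h.snd_mem, h.adj_sub⟩⟩
  by_contra hn
  have hbr := hG.isBridge (e := s(x, y)) hxy fun h => hn (hCK.2 h)
  obtain ⟨r, hr⟩ := exists_walk_of_connected hK hx hy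
  exact hn (hr _ (isBridge_iff_forall_walk_mem_edges.1 hbr r))

end Unicyclic

/-! ### The two hitting time formulas -/

section Formulas

variable {V : Type*} {G : SimpleGraph V} {C : G.Subgraph}

theorem IsUnicyclicWith.nontrivial (hG : IsUnicyclicWith G C) : Nontrivial V := by
  obtain ⟨v, c, hc, -⟩ := hG.isCycle
  exact ⟨v, c.snd, (c.adj_snd hc.not_nil).ne⟩

theorem IsUnicyclicWith.affineAlong_of_componentVerts (hG : IsUnicyclicWith G C) {φ : V → ℝ}
    {β : ℝ} {a b : V} (h : (G.deleteEdges C.edgeSet).Reachable a b) (p : G.Walk a b)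
    (hp : p.IsPath) (hφ : ∀ v ∈ p.support, φ v = β + G.dist v b) : AffineAlong φ β 1 p :=
  affineAlong_of_isBridge p hp (fun e he => hG.isBridge (p.edges_subset_edgeSet he)
    (hG.notMem_cycle_of_path h p hp e he)) hφ

variable [Fintype V] [DecidableEq V] [DecidableRel G.Adj]

/-- Hitting times between two vertices of the same tree branch. -/
theorem IsHittingSolution.eq_of_same_branch (hG : IsUnicyclicWith G C) {a b : V} {h : V → ℝ}
    (H : IsHittingSolution G b h) (hab : (G.deleteEdges C.edgeSet).Reachable a b)
    (P : G.Walk a b) (hP : P.IsPath) :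
    h a = (G.dist a b : ℝ) ^ 2 + 2 * ∑ v ∈ P.support.toFinset,
      (componentEdgeCount G P.toSubgraph v : ℝ) * (G.dist v b : ℝ) := by
  have hbr : ∀ e ∈ P.edges, G.IsBridge e := fun e he =>
    hG.isBridge (P.edges_subset_edgeSet he) (hG.notMem_cycle_of_path hab P hP e he)
  have haff : AffineAlong (fun v => (G.dist v b : ℝ)) 0 1 P :=
    affineAlong_of_isBridge P hP hbr fun v _ => (zero_add _).symm
  have key := H.sum_edges_eq hG.connected P.toSubgraph P.support.toFinset
    (by ext; simp) (by simp) (fun x hx y hy hxy => by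
      obtain ⟨q, -, hq⟩ := exists_walk_of_reachable_deleteEdges hxy
      exact eq_of_walk_avoiding_path P hP hbr (by simpa using hx) (by simpa using hy) q
        fun e he he' => hq e he ((Walk.mem_edges_toSubgraph P).2 he'))
    P.edges hP.isTrail.edges_nodup (fun e => (Walk.mem_edges_toSubgraph P).symm)
    (fun v => (G.dist v b : ℝ)) (by simp)
  rw [haff.sum_edgeMul, haff.sum_edgeAdd, H.target] at key
  rw [dist_eq_length_of_isBridge P hP hbr]
  linarith

/-- Hitting times between two vertices of different tree branches. -/
theorem IsHittingSolution.eq_of_ne_branch (hG : IsUnicyclicWith G C) {l : ℕ}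
    (hl : l = C.edgeSet.ncard) {i j a b : V} (hi : i ∈ C.verts) (hj : j ∈ C.verts) (hij : i ≠ j)
    {h : V → ℝ} (H : IsHittingSolution G b h) (ha : (G.deleteEdges C.edgeSet).Reachable i a)
    (hb : (G.deleteEdges C.edgeSet).Reachable j b) (p : G.Walk a i) (q : G.Walk j b)
    (hp : p.IsPath) (hq : q.IsPath) (m : V → ℕ)
    (hm : ∀ v, m v = componentEdgeCount G (coreSubgraph C p q) v) :
    h a =
        2 * ∑ v ∈ p.support.toFinset, (m v : ℝ) *
            ((G.dist v i : ℝ) + (G.dist j b : ℝ)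
              + (G.dist i j : ℝ) * ((l : ℝ) - (G.dist i j : ℝ)) / (l : ℝ))
        + 2 * ∑ v ∈ q.support.toFinset, (m v : ℝ) * (G.dist v b : ℝ)
        + 2 * ∑ k ∈ (Set.toFinite (C.verts \ {i, j})).toFinset, (m k : ℝ) *
            ((G.dist j b : ℝ) + (firstArcLength C i j k : ℝ)
              * (secondArcLength C i j k : ℝ) / (l : ℝ))
        + (G.dist a i : ℝ) ^ 2 + (G.dist j b : ℝ) ^ 2
        + 2 * ((l : ℝ) + (G.dist a i : ℝ)) * (G.dist j b : ℝ)
        + ((l : ℝ) + 2 * (G.dist a i : ℝ)) / (l : ℝ)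
            * ((G.dist i j : ℝ) * ((l : ℝ) - (G.dist i j : ℝ))) := by
  have hpC := hG.notMem_cycle_of_path ha.symm p hp
  have hqC := hG.notMem_cycle_of_path hb q hq
  have hpr : ∀ v ∈ p.support, (G.deleteEdges C.edgeSet).Reachable i v := fun v hv =>
    ha.trans (reachable_deleteEdges_of_mem_support p hpC hv)
  have hqr : ∀ v ∈ q.support, (G.deleteEdges C.edgeSet).Reachable j v := fun v hv =>
    reachable_deleteEdges_of_mem_support q hqC hv
  have hpi : ∀ v ∈ p.support, v ∈ C.verts → v = i := fun v hv hvC =>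
    (hG.eq_of_reachable hG.connected_cycle le_rfl hi hvC (hpr v hv)).symm
  have hqj : ∀ v ∈ q.support, v ∈ C.verts → v = j := fun v hv hvC =>
    (hG.eq_of_reachable hG.connected_cycle le_rfl hj hvC (hqr v hv)).symm
  have hpq : ∀ v ∈ p.support, v ∉ q.support := fun v hv hv' =>
    hij (hG.eq_of_reachable hG.connected_cycle le_rfl hi hj ((hpr v hv).trans (hqr v hv').symm))
  set D : ℝ := ((G.dist i j : ℕ) : ℝ) with hD
  set c : ℝ := D * (l - D) / l with hc
  -- The potential on G_0 of a unit current from `a` to `b`, grounded at `b`; `c` is the effective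
  -- resistance between `i` and `j`. Only the values on G_0 matter.
  let φ : V → ℝ := fun v =>
    if v ∈ p.support then (G.dist v i : ℝ) + (G.dist j b : ℝ) + c
    else if v ∈ q.support then (G.dist v b : ℝ)
    else (G.dist j b : ℝ) + (firstArcLength C i j v : ℝ) * (secondArcLength C i j v : ℝ) / (l : ℝ)
  have hφp : ∀ v ∈ p.support, φ v = (G.dist v i : ℝ) + (G.dist j b : ℝ) + c := fun v hv =>
    if_pos hv
  have hφq : ∀ v ∈ q.support, φ v = (G.dist v b : ℝ) := fun v hv => by
    simp only [φ, if_neg fun h => hpq v h hv, if_pos hv]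
  -- The product is symmetric, so it does not matter which arc realises the distance.
  have hprod : ∀ A B : G.Walk i j, IsArcs C A B → D * (l - D) = A.length * B.length :=
    fun A B hAB => by
      have hl' : (l : ℝ) = A.length + B.length := by rw [hl, hAB.ncard]; push_cast; rfl
      rcases hG.dist_arcs hAB with h | h <;> rw [hD, h, hl'] <;> ring
  -- The current through an arc is proportional to the length of the opposite one. For interior k on
  -- `A`, P_{ijk} runs along all of `B` and then back along `A`, so m_{ij} = |B| and m_{jk} is the
  -- remaining length of `A`.
  have harc : ∀ A B : G.Walk i j, IsArcs C A B →
      AffineAlong φ (G.dist j b : ℝ) (B.length / l : ℝ) A := by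
    rintro A B hAB v A₁ A₂ rfl
    have hvC : v ∈ C.verts := (hAB.mem_verts v).2 (.inl (by simp))
    by_cases hvi : v = i
    · subst hvi
      have h0 : A₁.length = 0 :=
        Walk.length_eq_zero_iff.2 (Walk.isPath_iff_nil.1 hAB.left.of_append_left)
      have h1 := hprod _ _ hAB
      rw [Walk.length_append, h0, zero_add] at h1
      rw [hφp v p.end_mem_support, hc, h1, SimpleGraph.dist_self]
      push_cast
      ring
    by_cases hvj : v = j
    · subst hvj
      have h0 : A₂.length = 0 :=
        Walk.length_eq_zero_iff.2 (Walk.isPath_iff_nil.1 hAB.left.of_append_right)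
      rw [hφq v q.start_mem_support, h0]
      simp
    · obtain ⟨h1, h2⟩ := hG.arcLength hAB hvi hvj
      simp only [φ, if_neg fun h => hvi (hpi v h hvC), if_neg fun h => hvj (hqj v h hvC), h1, h2]
      ring
  obtain ⟨A, B, hAB⟩ := exists_isArcs hG.isCycle hi hj hij
  have hA := harc A B hAB
  have hB := harc B A hAB.symm
  have hP : AffineAlong φ ((G.dist j b : ℝ) + c) 1 p :=
    hG.affineAlong_of_componentVerts ha.symm p hp fun v hv => by rw [hφp v hv]; ring
  have hQ : AffineAlong φ 0 1 q :=
    hG.affineAlong_of_componentVerts hb q hq fun v hv => by rw [hφq v hv, zero_add]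
  set K : G.Subgraph := p.toSubgraph ⊔ C ⊔ q.toSubgraph with hK
  have hCK : C ≤ K := le_sup_right.trans le_sup_left
  have hKc : K.Connected := by
    refine Subgraph.connected_sup (Subgraph.connected_sup p.toSubgraph_connected.preconnected
      hG.connected_cycle.preconnected ⟨i, by simp, hi⟩).preconnected
      q.toSubgraph_connected.preconnected ⟨j, .inr hj, by simp⟩
  have hKv : K.verts = {v | v ∈ p.support} ∪ {v | v ∈ q.support} ∪ C.verts := by
    ext v
    simp only [hK, Subgraph.verts_sup, Walk.verts_toSubgraph, Set.mem_union, Set.mem_ofPred_eq]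
    tauto
  have hcore : coreSubgraph C p q = K := hG.eq_coreSubgraph p q hKc hCK hKv
  let R : Finset V := (Set.toFinite (C.verts \ {i, j})).toFinset
  have hR : ∀ v, v ∈ R ↔ v ∈ C.verts ∧ v ≠ i ∧ v ≠ j := fun v => by simp [R]
  have hdisj₁ : Disjoint p.support.toFinset q.support.toFinset :=
    Finset.disjoint_left.2 fun v hv hv' => hpq v (by simpa using hv) (by simpa using hv')
  have hdisj₂ : Disjoint (p.support.toFinset ∪ q.support.toFinset) R :=
    Finset.disjoint_left.2 fun v hv hvR => by
      obtain ⟨hvC, hvi, hvj⟩ := (hR v).1 hvR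
      rw [Finset.mem_union, List.mem_toFinset, List.mem_toFinset] at hv
      exact hv.elim (fun h => hvi (hpi v h hvC)) fun h => hvj (hqj v h hvC)
  have hS : K.verts = ((p.support.toFinset ∪ q.support.toFinset ∪ R : Finset V) : Set V) := by
    ext v
    have hvi : v = i → v ∈ p.support := fun h => h ▸ p.end_mem_support
    have hvj : v = j → v ∈ q.support := fun h => h ▸ q.start_mem_support
    simp only [hKv, Set.mem_union, Set.mem_ofPred_eq, Finset.coe_union, List.coe_toFinset,
      Finset.mem_coe, hR]
    tauto
  have hmemE : ∀ e, e ∈ p.edges ++ (q.edges ++ (A.edges ++ B.edges)) ↔ e ∈ K.edgeSet := fun e => by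
    simp only [hK, Subgraph.edgeSet_sup, Set.mem_union, Walk.mem_edges_toSubgraph, hAB.mem_edges,
      List.mem_append]
    tauto
  have hnd : (p.edges ++ (q.edges ++ (A.edges ++ B.edges))).Nodup := by
    have hABC : ∀ e, e ∈ A.edges ++ B.edges → e ∈ C.edgeSet := fun e he =>
      (hAB.mem_edges e).2 (List.mem_append.1 he)
    refine List.nodup_append'.2 ⟨hp.isTrail.edges_nodup, List.nodup_append'.2
      ⟨hq.isTrail.edges_nodup, hAB.nodup, fun e h1 h2 => hqC e h1 (hABC e h2)⟩, fun e h1 h2 => ?_⟩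
    rcases List.mem_append.1 h2 with h2 | h2
    · induction e with | _ x y =>
      exact hpq x (p.fst_mem_support_of_mem_edges h1) (q.fst_mem_support_of_mem_edges h2)
    · exact hpC e h1 (hABC e h2)
  have key := H.sum_edges_eq hG.connected K _ hS (by simp)
    (fun x hx y hy hxy => hG.eq_of_reachable hKc hCK (by rw [hS]; exact hx)
      (by rw [hS]; exact hy) hxy) _ hnd hmemE φ (by rw [hφq b q.end_mem_support]; simp)
  rw [Finset.sum_union hdisj₂, Finset.sum_union hdisj₁] at key
  simp only [List.map_append, List.sum_append, hP.sum_edgeMul, hQ.sum_edgeMul, hA.sum_edgeMul,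
    hB.sum_edgeMul, hP.sum_edgeAdd, hQ.sum_edgeAdd, hA.sum_edgeAdd, hB.sum_edgeAdd, H.target,
    ← hcore, ← hm] at key
  have e1 : ∑ v ∈ p.support.toFinset, (m v : ℝ) * φ v = ∑ v ∈ p.support.toFinset, (m v : ℝ) *
      ((G.dist v i : ℝ) + (G.dist j b : ℝ) + c) :=
    Finset.sum_congr rfl fun v hv => by rw [hφp v (by simpa using hv)]
  have e2 : ∑ v ∈ q.support.toFinset, (m v : ℝ) * φ v =
      ∑ v ∈ q.support.toFinset, (m v : ℝ) * (G.dist v b : ℝ) :=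
    Finset.sum_congr rfl fun v hv => by rw [hφq v (by simpa using hv)]
  have e3 : ∑ v ∈ R, (m v : ℝ) * φ v = ∑ v ∈ R, (m v : ℝ) * ((G.dist j b : ℝ) +
      (firstArcLength C i j v : ℝ) * (secondArcLength C i j v : ℝ) / (l : ℝ)) :=
    Finset.sum_congr rfl fun v hv => by
      obtain ⟨hvC, hvi, hvj⟩ := (hR v).1 hv
      simp only [φ, if_neg fun h => hvi (hpi v h hvC), if_neg fun h => hvj (hqj v h hvC)]
  rw [e1, e2, e3] at key
  have hpl : G.dist a i = p.length := dist_eq_length_of_isBridge p hp fun e he =>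
    hG.isBridge (p.edges_subset_edgeSet he) (hpC e he)
  have hql : G.dist j b = q.length := dist_eq_length_of_isBridge q hq fun e he =>
    hG.isBridge (q.edges_subset_edgeSet he) (hqC e he)
  have hl' : (l : ℝ) = A.length + B.length := by rw [hl, hAB.ncard]; push_cast; rfl
  have hl0 : (l : ℝ) ≠ 0 := by
    have : (0 : ℝ) < A.length := by exact_mod_cast hAB.length_pos
    rw [hl']
    positivity
  -- The two arc currents add up to one, so the sum telescopes through the cycle.
  have hlin : (B.length / l : ℝ) * (h i - h j) + A.length / l * (h i - h j) = h i - h j := by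
    rw [← add_mul, ← add_div, add_comm (B.length : ℝ), ← hl', div_self hl0, one_mul]
  have hquad : (A.length : ℝ) * (2 * (G.dist j b : ℝ) + B.length / l * A.length) +
      B.length * (2 * (G.dist j b : ℝ) + A.length / l * B.length) =
      2 * l * (G.dist j b : ℝ) + D * (l - D) := by
    rw [hprod A B hAB]
    field_simp
    rw [hl']
    ring
  have hlast : ((l : ℝ) + 2 * (G.dist a i : ℝ)) / (l : ℝ) * (D * ((l : ℝ) - D)) =
      D * (l - D) + 2 * (G.dist a i : ℝ) * c := by
    rw [hc]
    field_simp
  rw [hlast]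
  rw [← hpl, ← hql] at key
  linear_combination key + hquad - hlin

end Formulas

end UnicyclicHitting

theorem mainTheorem7 {V : Type*} [Finite V] [DecidableEq V] (G : SimpleGraph V) (C : G.Subgraph)
    (hG : UnicyclicHitting.IsUnicyclicWith G C) (l : ℕ) (hl : l = C.edgeSet.ncard) :
    -- `a` and `b` in different tree branches `T_i` and `T_j`
    (∀ (i j a b : V), i ∈ C.verts → j ∈ C.verts → i ≠ j →
      a ∈ UnicyclicHitting.componentVerts G C i → b ∈ UnicyclicHitting.componentVerts G C j →
      ∀ (Pai : G.Walk a i) (Pjb : G.Walk j b), Pai.IsPath → Pjb.IsPath →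
      ∀ m : V → ℕ, (∀ v, m v = UnicyclicHitting.componentEdgeCount G
          (UnicyclicHitting.coreSubgraph C Pai Pjb) v) →
      UnicyclicHitting.hittingTime G a b ≠ ∞ ∧
      (UnicyclicHitting.hittingTime G a b).toReal =
        2 * ∑ v ∈ Pai.support.toFinset, (m v : ℝ) *
            ((G.dist v i : ℝ) + (G.dist j b : ℝ)
              + (G.dist i j : ℝ) * ((l : ℝ) - (G.dist i j : ℝ)) / (l : ℝ))
        + 2 * ∑ v ∈ Pjb.support.toFinset, (m v : ℝ) * (G.dist v b : ℝ)
        + 2 * ∑ k ∈ (Set.toFinite (C.verts \ {i, j})).toFinset, (m k : ℝ) *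
            ((G.dist j b : ℝ) + (UnicyclicHitting.firstArcLength C i j k : ℝ)
              * (UnicyclicHitting.secondArcLength C i j k : ℝ) / (l : ℝ))
        + (G.dist a i : ℝ) ^ 2 + (G.dist j b : ℝ) ^ 2
        + 2 * ((l : ℝ) + (G.dist a i : ℝ)) * (G.dist j b : ℝ)
        + ((l : ℝ) + 2 * (G.dist a i : ℝ)) / (l : ℝ)
            * ((G.dist i j : ℝ) * ((l : ℝ) - (G.dist i j : ℝ)))) ∧
    -- `a` and `b` in the same tree branch `T_i`
    (∀ (i a b : V), i ∈ C.verts →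
      a ∈ UnicyclicHitting.componentVerts G C i → b ∈ UnicyclicHitting.componentVerts G C i →
      ∀ P : G.Walk a b, P.IsPath →
      ∀ m : V → ℕ, (∀ v, m v = UnicyclicHitting.componentEdgeCount G P.toSubgraph v) →
      UnicyclicHitting.hittingTime G a b ≠ ∞ ∧
      (UnicyclicHitting.hittingTime G a b).toReal =
        (G.dist a b : ℝ) ^ 2
          + 2 * ∑ v ∈ P.support.toFinset, (m v : ℝ) * (G.dist v b : ℝ)) := by
  have := Fintype.ofFinite V
  classical
  have := hG.nontrivial
  refine ⟨fun i j a b hi hj hij ha hb p q hp hq m hm => ?_, fun i a b _ ha hb P hP m hm => ?_⟩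
  all_goals
    obtain ⟨h, H⟩ := UnicyclicHitting.exists_isHittingSolution hG.connected b
    rw [H.hittingTime_eq a]
    refine ⟨ENNReal.ofReal_ne_top, ?_⟩
    rw [ENNReal.toReal_ofReal (H.nonneg a)]
  · exact H.eq_of_ne_branch hG hl hi hj hij ha hb p q hp hq m hm
  · rw [H.eq_of_same_branch hG (ha.symm.trans hb) P hP]
    simp_rw [hm]
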